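/- Let $\mathbb{O}$ be the algebra of octonions with its standard basis $e_0=1,e_1,\dots,e_7$, where $e_ie_j=-\delta_{ij}+\sum_{k=1}^7\epsilon_{ijk}e_k$ for $1\le i,j\le 7$ and $\epsilon_{ijk}$ is the totally antisymmetric symbol that equals $1$ on the triples $(1,2,3),(1,4,5),(2,4,6),(3,4,7),(5,3,6),(6,1,7),(7,2,5)$ and vanishes on all triples that are not permutations of these. Fix $p\in\{0,1,\dots,6\}$, put $q=7-p$, and identify $\mathbb{R}^{p+1}$ with the span of $e_0,\dots,e_p$ and $\mathbb{R}^q$ with the span of $e_{p+1},\dots,e_7$. Let $\mathbb{S}$ be the unit sphere of $\mathbb{R}^q$. Every $\boldsymbol{x}\in\mathbb{O}=\mathbb{R}^{p+1}\oplus\mathbb{R}^q$ can be written as $\boldsymbol{x}=\boldsymbol{x}_p+r\underline{\omega}$ with $\boldsymbol{x}_p\in\mathbb{R}^{p+1}$, $r\ge 0$, $\underline{\omega}\in\mathbb{S}$. Write $D_{\boldsymbol{x}_p}=\sum_{i=0}^p e_i\partial_{x_i}$ (acting by multiplication from the left) and $\Delta_{\boldsymbol{x}_p}=\sum_{i=0}^p\partial_{x_i}^2$.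 A function $f:\mathbb{O}\to\mathbb{O}$ is called (left) generalized partial-slice monogenic of type $p$ on $\mathbb{O}$ if, for every $\underline{\omega}\in\mathbb{S}$, the function $(\boldsymbol{x}_p,r)\mapsto f(\boldsymbol{x}_p+r\underline{\omega})$ is of class $C^1$ on $\mathbb{R}^{p+1}\times\mathbb{R}$ and satisfies $(D_{\boldsymbol{x}_p}+\underline{\omega}\,\partial_r)f(\boldsymbol{x}_p+r\underline{\omega})=0$ there. Let $f_0:\mathbb{R}^{p+1}\to\mathbb{O}$ be a polynomial, that is, each of its eight real components is a real polynomial in $x_0,\dots,x_p$. Its generalized partial-slice Cauchy–Kovalevskaya extension $CK[f_0]:\mathbb{O}\to\mathbb{O}$ is defined by $$CK[f_0](\boldsymbol{x}_p+r\underline{\omega})=\sum_{k=0}^{\infty}\frac{r^{2k}}{(2k)!}(-\Delta_{\boldsymbol{x}_p})^k f_0(\boldsymbol{x}_p)+\underline{\omega}\sum_{k=0}^{\infty}\frac{r^{2k+1}}{(2k+1)!}(-\Delta_{\boldsymbol{x}_p})^k\big(D_{\boldsymbol{x}_p}f_0\big)(\boldsymbol{x}_p),$$ where $\boldsymbol{x}_p\in\mathbb{R}^{p+1}$,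 $r\ge 0$, $\underline{\omega}\in\mathbb{S}$; both sums have only finitely many nonzero terms, and the value at $r=0$ does not depend on $\underline{\omega}$. \textbf{Theorem (CK-extension).} For every polynomial $f_0:\mathbb{R}^{p+1}\to\mathbb{O}$, the function $CK[f_0]$ is generalized partial-slice monogenic of type $p$ on $\mathbb{O}$, it satisfies $CK[f_0](\boldsymbol{x}_p)=f_0(\boldsymbol{x}_p)$ for all $\boldsymbol{x}_p\in\mathbb{R}^{p+1}$, and it is the only generalized partial-slice monogenic function of type $p$ on $\mathbb{O}$ whose restriction to $\mathbb{R}^{p+1}$ is $f_0$. -/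

import Mathlib

/-!
Fix `ω ∈ 𝕊`. Moving `ω` past a vector of `ℝ^{p+1}` conjugates the vector, so `v ↦ ω (v ·)` is a
Clifford action of `ℝ^{p+1}` on `𝕆`. With `T = ω D_{x_p}`, multiplication by `ω` turns `D_ω F = 0`
into the evolution equation `∂_r F = T F`, and `T² = -Δ`. Separating even and odd powers of `T`, the
restriction of `CK[f₀]` to the slice of `ω` is `exp(r T) f₀`, a finite sum for polynomial `f₀`.

For uniqueness, let `F` be a `C¹` solution of `∂_r F = T F` with `F = 0` on `r = 0`. Then `dF = 0`
there, so replacing `F` by `0` for `r < 0` yields another `C¹` solution, and it remains to see that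
a solution which vanishes on an open set `U` vanishes identically. The operators `∂_r ∓ T` compose
to the Laplacian, whence the mean value property: the integral of `F` against any radial weight
centred at a point of `U` vanishes. Differentiating in the centre shows that this persists after
multiplying `F` by linear functions, hence by polynomials, and the Stone–Weierstrass theorem gives
`F = 0`. This works for solutions of class `C¹`, with no appeal to elliptic regularity.
-/

namespace OctonionCK

noncomputable section

/-! ### The octonions -/

/-- The octonions: the real vector space `ℝ⁸` with its Euclidean norm; the coordinate vector
`(x₀, …, x₇)` is the octonion `x₀ + x₁ e₁ + ⋯ + x₇ e₇`. The product is `instMulOctonion`. -/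
abbrev Octonion : Type := EuclideanSpace ℝ (Fin 8)

/-- The oriented triples `(i, j, k)` with `e_i e_j = e_k`, up to cyclic permutation. -/
def octTriples : List (Fin 8 × Fin 8 × Fin 8) :=
  [(1, 2, 3), (1, 4, 5), (2, 4, 6), (3, 4, 7), (5, 3, 6), (6, 1, 7), (7, 2, 5)]

/-- The totally antisymmetric symbol `ε_{ijk}`: it is the sign of `σ` if `(i, j, k)` is the
permutation `σ` of one of the triples, and `0` otherwise. -/
def octEps (i j k : Fin 8) : ℤ :=
  if (i, j, k) ∈ octTriples ∨ (j, k, i) ∈ octTriples ∨ (k, i, j) ∈ octTriples then 1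
  else if (j, i, k) ∈ octTriples ∨ (i, k, j) ∈ octTriples ∨ (k, j, i) ∈ octTriples then -1
  else 0

/-- The coefficient of `e_k` in `e_i e_j`: `e₀` is the unit, and
`e_i e_j = -δ_{ij} + ∑_k ε_{ijk} e_k` for `i, j, k ∈ {1, …, 7}`. -/
def octConst (i j k : Fin 8) : ℤ :=
  if i = 0 then (if j = k then 1 else 0)
  else if j = 0 then (if i = k then 1 else 0)
  else if k = 0 then (if i = j then -1 else 0)
  else octEps i j k

/-- The bilinear octonion product. -/
instance instMulOctonion : Mul Octonion :=
  ⟨fun x y => WithLp.toLp 2 fun k => ∑ i, ∑ j, (octConst i j k : ℝ) * (x i * y j)⟩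

/-- The basis octonions `e₀ = 1, e₁, …, e₇`. -/
def e (i : Fin 8) : Octonion := EuclideanSpace.single i 1

/-! ### The splitting `𝕆 = ℝ^{p+1} ⊕ ℝ^q`, `q = 7 - p`, for `p ∈ {0, …, 6}` -/

/-- The space `ℝ^{p+1}`. -/
abbrev Base (p : Fin 7) : Type := EuclideanSpace ℝ (Fin ((p : ℕ) + 1))

/-- The inclusion of the indices `0, …, p` into `0, …, 7`. -/
def idx (p : Fin 7) (i : Fin ((p : ℕ) + 1)) : Fin 8 := Fin.castLE (by omega) i

/-- The inclusion `ℝ^{p+1} ⊆ 𝕆`, `(x₀, …, x_p) ↦ ∑_{i ≤ p} x_i e_i`. -/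
def emb (p : Fin 7) (x : Base p) : Octonion := ∑ i, x i • e (idx p i)

/-- The component in `ℝ^{p+1}` of an octonion. -/
def basePart (p : Fin 7) (x : Octonion) : Base p := WithLp.toLp 2 fun i => x (idx p i)

/-- The component in `ℝ^q` of an octonion, `∑_{i > p} x_i e_i`. -/
def restPart (p : Fin 7) (x : Octonion) : Octonion := x - emb p (basePart p x)

/-- The unit sphere `𝕊` of `ℝ^q`, consisting of the unit octonions in the span
of `e_{p+1}, …, e₇`. -/
def sphere (p : Fin 7) : Set Octonion :=
  {ω | (∀ i : Fin 8, (i : ℕ) ≤ (p : ℕ) → ω i = 0) ∧ ‖ω‖ = 1}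

/-! ### Generalized partial-slice monogenic functions -/

/-- The parametrization `(x_p, r) ↦ x_p + r ω` of the slice `ℝ^{p+1} ⊕ ω ℝ` by `ℝ^{p+1} × ℝ`. -/
def slice (p : Fin 7) (ω : Octonion) (y : Base p × ℝ) : Octonion := emb p y.1 + y.2 • ω

/-- The operator `D_ω = ∑_{i ≤ p} e_i ∂_{x_i} + ω ∂_r`, acting from the left on functions of
`(x_p, r)`. -/
def sliceD (p : Fin 7) (ω : Octonion) (F : Base p × ℝ → Octonion) (y : Base p × ℝ) : Octonion :=
  (∑ i, e (idx p i) * fderiv ℝ F y (EuclideanSpace.single i 1, 0)) + ω * fderiv ℝ F y (0, 1)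

/-- `f` is (left) generalized partial-slice monogenic of type `p` on the domain `Ω`:
for each `ω ∈ 𝕊` its restriction to `Ω ∩ (ℝ^{p+1} ⊕ ω ℝ)` is of class `C¹` and is annihilated
by `D_ω`. Only the values of `f` on `Ω` matter. -/
def IsGSM (p : Fin 7) (Ω : Set Octonion) (f : Octonion → Octonion) : Prop :=
  ∀ ω ∈ sphere p,
    ContDiffOn ℝ 1 (f ∘ slice p ω) (slice p ω ⁻¹' Ω) ∧
    ∀ y ∈ slice p ω ⁻¹' Ω, sliceD p ω (f ∘ slice p ω) y = 0

/-! ### The Cauchy–Kovalevskaya extension -/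

/-- `f₀ : ℝ^{p+1} → 𝕆` is a polynomial: each of its eight real components is a real polynomial
in `x₀, …, x_p`. -/
def IsPolynomialMap (p : Fin 7) (f₀ : Base p → Octonion) : Prop :=
  ∀ j : Fin 8, ∃ P : MvPolynomial (Fin ((p : ℕ) + 1)) ℝ,
    ∀ x : Base p, f₀ x j = MvPolynomial.eval (fun i => x i) P

/-- The operator `D_{x_p} = ∑_{i ≤ p} e_i ∂_{x_i}`, acting from the left. -/
def baseD (p : Fin 7) (f : Base p → Octonion) (x : Base p) : Octonion :=
  ∑ i, e (idx p i) * fderiv ℝ f x (EuclideanSpace.single i 1)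

/-- The operator `(-Δ)^k`, with `Δ` the Laplacian of `ℝ^{p+1}`. -/
def negLaplacianPow (p : Fin 7) (k : ℕ) (f : Base p → Octonion) : Base p → Octonion :=
  (fun g : Base p → Octonion => -(Laplacian.laplacian g))^[k] f

/-- The value of the extension series at `x_p + r ω`:
`∑_k r^{2k}/(2k)! (-Δ)^k f₀(x_p) + ω ∑_k r^{2k+1}/(2k+1)! (-Δ)^k (D_{x_p} f₀)(x_p)`. -/
def ckSeries (p : Fin 7) (f₀ : Base p → Octonion) (x : Base p) (r : ℝ) (ω : Octonion) :
    Octonion :=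
  (∑' k : ℕ, (r ^ (2 * k) / ((2 * k).factorial : ℝ)) • negLaplacianPow p k f₀ x) +
  ω * ∑' k : ℕ,
    (r ^ (2 * k + 1) / ((2 * k + 1).factorial : ℝ)) • negLaplacianPow p k (baseD p f₀) x

/-- The generalized partial-slice Cauchy–Kovalevskaya extension `CK[f₀] : 𝕆 → 𝕆`: the series is
evaluated at `r = |x_q|` and `ω = x_q / |x_q|`. When `x_q = 0` the second sum vanishes, so the
choice of `ω` is irrelevant; see `CK_slice`. -/
def CK (p : Fin 7) (f₀ : Base p → Octonion) (x : Octonion) : Octonion :=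
  ckSeries p f₀ (basePart p x) ‖restPart p x‖ (‖restPart p x‖⁻¹ • restPart p x)

/-! ### Consistency of the definition of `CK` -/

theorem emb_apply (p : Fin 7) (x : Base p) (i : Fin ((p : ℕ) + 1)) : emb p x (idx p i) = x i := by
  have h : ∀ j, (idx p i = idx p j) = (i = j) := fun j => by
    simp [idx, Fin.ext_iff]
  simp [emb, e, Pi.single_apply, h]

theorem basePart_slice (p : Fin 7) {ω : Octonion} (hω : ω ∈ sphere p) (y : Base p × ℝ) :
    basePart p (slice p ω y) = y.1 := by
  ext i
  have h : ω (idx p i) = 0 := hω.1 _ (by simp [idx]; omega)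
  simp [basePart, slice, emb_apply, h]

theorem restPart_slice (p : Fin 7) {ω : Octonion} (hω : ω ∈ sphere p) (y : Base p × ℝ) :
    restPart p (slice p ω y) = y.2 • ω := by
  rw [restPart, basePart_slice p hω]
  simp [slice]

theorem mul_zero_oct (x : Octonion) : x * (0 : Octonion) = 0 := by
  ext k
  change ∑ i, ∑ j, (octConst i j k : ℝ) * (x i * (0 : Octonion) j) = 0
  simp

/-- `CK[f₀]` takes the prescribed value at `x_p + r ω` for all `r ≥ 0` and all `ω ∈ 𝕊`. -/
theorem CK_slice (p : Fin 7) (f₀ : Base p → Octonion) {ω : Octonion} (hω : ω ∈ sphere p)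
    (x : Base p) {r : ℝ} (hr : 0 ≤ r) :
    CK p f₀ (slice p ω (x, r)) = ckSeries p f₀ x r ω := by
  have hn : ‖r • ω‖ = r := by rw [norm_smul, hω.2, mul_one, Real.norm_of_nonneg hr]
  rw [CK, basePart_slice p hω, restPart_slice p hω]
  simp only [hn]
  rcases hr.eq_or_lt with h | h
  · subst h
    simp [ckSeries, mul_zero_oct]
  · rw [smul_smul, inv_mul_cancel₀ h.ne', one_smul]

end

end OctonionCK

namespace OctonionCK

noncomputable section

section DiracOperators

open Laplacian

variable {ι E V : Type*} [Fintype ι] [NormedAddCommGroup E] [InnerProductSpace ℝ E]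
  [NormedAddCommGroup V] [NormedSpace ℝ V]

/-- The constant-coefficient first-order operator `∑ᵢ A(bᵢ) ∂ᵢ` with symbol `A`, where `∂ᵢ` is the
derivative along the vector `bᵢ` of an orthonormal basis. -/
def dirac (b : OrthonormalBasis ι ℝ E) (A : E →ₗ[ℝ] V →L[ℝ] V) (u : E → V) (y : E) : V :=
  ∑ i, A (b i) (fderiv ℝ u y (b i))

/-- The symbols `A'` and `A` compose to the squared norm, so that the operators with these symbols
compose to the Laplacian. -/
def FactorsNormSq (A' A : E →ₗ[ℝ] V →L[ℝ] V) : Prop :=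
  ∀ v x, A' v (A v x) = ‖v‖ ^ 2 • x

variable {A A' : E →ₗ[ℝ] V →L[ℝ] V}

theorem FactorsNormSq.polarization (hA : FactorsNormSq A' A) (v w : E) (x : V) :
    A' v (A w x) + A' w (A v x) = (2 * inner ℝ v w) • x := by
  have h := hA (v + w) x
  rw [map_add, map_add, _root_.add_apply, _root_.add_apply, map_add, map_add, hA, hA,
    norm_add_sq_real] at h
  linear_combination (norm := module) h

theorem FactorsNormSq.sum_sum_eq_of_symm (hA : FactorsNormSq A' A) (b : OrthonormalBasis ι ℝ E)
    {q : ι → ι → V} (hq : ∀ i j, q i j = q j i) :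
    ∑ i, ∑ j, A' (b i) (A (b j) (q i j)) = ∑ i, q i i := by
  classical
  have two_smul_sum : (2 : ℝ) • ∑ i, ∑ j, A' (b i) (A (b j) (q i j)) = (2 : ℝ) • ∑ i, q i i := by
    calc (2 : ℝ) • ∑ i, ∑ j, A' (b i) (A (b j) (q i j))
        = ∑ i, ∑ j, (A' (b i) (A (b j) (q i j)) + A' (b j) (A (b i) (q i j))) := by
          simp only [Finset.sum_add_distrib]
          rw [two_smul, Finset.sum_comm (f := fun i j => A' (b j) (A (b i) (q i j)))]
          simp only [hq]
      _ = (2 : ℝ) • ∑ i, q i i := by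
          simp [hA.polarization, b.inner_eq_ite, Finset.smul_sum, ite_smul]
  exact smul_right_injective V two_ne_zero two_smul_sum

theorem hasFDerivAt_dirac (b : OrthonormalBasis ι ℝ E) (A : E →ₗ[ℝ] V →L[ℝ] V) {u : E → V} {y : E}
    (hu : DifferentiableAt ℝ (fderiv ℝ u) y) :
    HasFDerivAt (dirac b A u)
      (∑ i, A (b i) ∘L (fderiv ℝ (fderiv ℝ u) y).flip (b i)) y := by
  refine HasFDerivAt.fun_sum fun i _ => (A (b i)).hasFDerivAt.comp y ?_
  convert! hu.hasFDerivAt.clm_apply (hasFDerivAt_const (b i) y) using 1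
  simp

theorem FactorsNormSq.dirac_dirac [FiniteDimensional ℝ E] (hA : FactorsNormSq A' A)
    (b : OrthonormalBasis ι ℝ E) {u : E → V} (hu : ContDiff ℝ 2 u) :
    dirac b A' (dirac b A u) = Δ u := by
  ext y
  have hessian_symm : IsSymmSndFDerivAt ℝ u y := hu.contDiffAt.isSymmSndFDerivAt (by simp)
  have hu' : DifferentiableAt ℝ (fderiv ℝ u) y :=
    (hu.fderiv_right le_rfl).differentiable one_ne_zero y
  calc dirac b A' (dirac b A u) y
      = ∑ i, ∑ j, A' (b i) (A (b j) (fderiv ℝ (fderiv ℝ u) y (b i) (b j))) := by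
        rw [dirac, (hasFDerivAt_dirac b A hu').fderiv]
        simp [map_sum]
    _ = ∑ i, fderiv ℝ (fderiv ℝ u) y (b i) (b i) :=
        hA.sum_sum_eq_of_symm b fun i j => hessian_symm _ _
    _ = Δ u y := by
        rw [InnerProductSpace.laplacian_eq_iteratedFDeriv_orthonormalBasis u b]
        simp [iteratedFDeriv_two_apply]

end DiracOperators

section MeanValue

open MeasureTheory Set

variable {ι E V : Type*} [Fintype ι] [NormedAddCommGroup E] [InnerProductSpace ℝ E]
  [NormedAddCommGroup V] [NormedSpace ℝ V]

theorem intervalIntegral_integral_swap_of_hasCompactSupport [FiniteDimensional ℝ E]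
    [MeasurableSpace E] [BorelSpace E] {w : E → ℝ} (hw : Continuous w) (hw' : HasCompactSupport w)
    {f : ℝ → E → V} (hf : Continuous (Function.uncurry f)) (s t : ℝ) :
    ∫ r in s..t, ∫ z, w z • f r z = ∫ z, ∫ r in s..t, w z • f r z := by
  refine intervalIntegral_integral_swap ?_
  rw [← Measure.restrict_univ (μ := (volume : Measure E)), Measure.prod_restrict]
  have hc : Continuous (Function.uncurry fun r z => w z • f r z) :=
    (hw.comp continuous_snd).smul hf
  refine IntegrableOn.of_forall_sdiff_eq_zero (s := uIcc s t ×ˢ tsupport w)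
    (hc.continuousOn.integrableOn_compact (isCompact_uIcc.prod hw'))
    (measurableSet_uIoc.prod .univ) fun q hq => ?_
  have hq2 : q.2 ∉ tsupport w := fun h => hq.2 ⟨uIoc_subset_uIcc hq.1.1, h⟩
  simp [Function.uncurry, image_eq_zero_of_notMem_tsupport hq2]

/-- A compactly supported weight whose gradient at `z` is `w' z • z` for a continuous factor `w'`,
as is the case for a `C¹` function of `‖z‖²`. -/
structure IsRadialWeight (w w' : E → ℝ) : Prop where
  hasFDerivAt (z : E) : HasFDerivAt w (w' z • innerSL ℝ z) z
  continuous_factor : Continuous w'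
  hasCompactSupport : HasCompactSupport w

namespace IsRadialWeight

variable {w w' : E → ℝ} {u : E → V}

theorem continuous (hw : IsRadialWeight w w') : Continuous w :=
  continuous_iff_continuousAt.2 fun z => (hw.hasFDerivAt z).continuousAt

variable [FiniteDimensional ℝ E] [MeasurableSpace E] [BorelSpace E]

theorem integrable_smul (hw : IsRadialWeight w w') (hu : Continuous u) :
    Integrable fun z => w z • u z :=
  (hw.continuous.smul hu).integrable_of_hasCompactSupport hw.hasCompactSupport.smul_right

theorem integral_smul_fderiv (hw : IsRadialWeight w w') (hu : ContDiff ℝ 1 u) (v v' : E) :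
    ∫ z, w z • inner ℝ v z • fderiv ℝ u z v' =
      -∫ z, (w z * inner ℝ v v' + w' z * inner ℝ v z * inner ℝ z v') • u z := by
  have hd (z : E) : HasFDerivAt (fun z => w z * inner ℝ v z)
      (w z • innerSL ℝ v + inner ℝ v z • w' z • innerSL ℝ z) z :=
    (hw.hasFDerivAt z).mul (innerSL ℝ v).hasFDerivAt
  have hd' (z : E) : fderiv ℝ (fun z => w z * inner ℝ v z) z v' =
      w z * inner ℝ v v' + w' z * inner ℝ v z * inner ℝ z v' := by
    rw [(hd z).fderiv]
    simp only [_root_.add_apply, _root_.smul_apply, innerSL_apply_apply, smul_eq_mul]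
    ring
  have hsupp : HasCompactSupport fun z => w z * inner ℝ v z := hw.hasCompactSupport.mul_right
  have := hu.continuous_fderiv one_ne_zero
  have := hw.continuous
  have := hw.continuous_factor
  have := hu.continuous
  simp_rw [smul_smul, ← hd']
  refine integral_smul_fderiv_eq_neg_fderiv_smul_of_integrable ?_ ?_ ?_
    (fun z _ => (hd z).differentiableAt) fun z _ => hu.differentiable one_ne_zero z
  · refine Continuous.integrable_of_hasCompactSupport ?_ (hsupp.fderiv_apply ℝ v').smul_right
    simp_rw [hd']
    fun_prop
  · exact Continuous.integrable_of_hasCompactSupport (by fun_prop) hsupp.smul_right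
  · exact Continuous.integrable_of_hasCompactSupport (by fun_prop) hsupp.smul_right

theorem integral_smul_fderiv_symm (hw : IsRadialWeight w w') (hu : ContDiff ℝ 1 u) (v v' : E) :
    ∫ z, w z • inner ℝ v z • fderiv ℝ u z v' = ∫ z, w z • inner ℝ v' z • fderiv ℝ u z v := by
  rw [hw.integral_smul_fderiv hu, hw.integral_smul_fderiv hu]
  congr! 4 with z
  rw [real_inner_comm v' v, real_inner_comm v z, real_inner_comm z v']
  ring

variable [CompleteSpace V] {A A' : E →ₗ[ℝ] V →L[ℝ] V}

/-- Since `z ↦ w z • z` is a gradient, `∫ w z ⟪bᵢ, z⟫ ∂ⱼu z` is symmetric in `i` and `j`;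
contracting it with `A'(bᵢ) A(bⱼ)` gives both `0` and the radial derivative. -/
theorem integral_smul_fderiv_self (hw : IsRadialWeight w w') (b : OrthonormalBasis ι ℝ E)
    (hA : FactorsNormSq A' A) (hu : ContDiff ℝ 1 u) (hAu : dirac b A u = 0) :
    ∫ z, w z • fderiv ℝ u z z = 0 := by
  have hu' (v : E) : Continuous fun z => fderiv ℝ u z v :=
    (hu.continuous_fderiv one_ne_zero).clm_apply continuous_const
  have hint (i j : ι) : Integrable fun z => w z • inner ℝ (b i) z • fderiv ℝ u z (b j) :=
    hw.integrable_smul (by have := hu' (b j); fun_prop)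
  calc ∫ z, w z • fderiv ℝ u z z
      = ∑ i, ∫ z, w z • inner ℝ (b i) z • fderiv ℝ u z (b i) := by
        rw [← integral_finsetSum _ fun i _ => hint i i]
        congr! 2 with z
        rw [← Finset.smul_sum]
        simpa using congrArg (w z • fderiv ℝ u z ·) (b.sum_repr' z).symm
    _ = ∑ i, ∑ j, A' (b i) (A (b j) (∫ z, w z • inner ℝ (b i) z • fderiv ℝ u z (b j))) :=
        (hA.sum_sum_eq_of_symm b fun i j => hw.integral_smul_fderiv_symm hu _ _).symm
    _ = ∑ i, A' (b i) (∫ z, w z • inner ℝ (b i) z • dirac b A u z) := by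
        congr! 1 with i
        simp_rw [← fun j => (A (b j)).integral_comp_comm (hint i j)]
        rw [← map_sum, ← integral_finsetSum _ fun j _ => (A (b j)).integrable_comp (hint i j)]
        simp only [map_smul, dirac, Finset.smul_sum]
    _ = 0 := by simp [hAu]

theorem integral_smul_fderiv_sub_smul (hw : IsRadialWeight w w') (b : OrthonormalBasis ι ℝ E)
    (hA : FactorsNormSq A' A) (hu : ContDiff ℝ 1 u) (hAu : dirac b A u = 0) (c : E) {t : ℝ}
    (ht : t ≠ 0) : ∫ z, w z • fderiv ℝ u (c - t • z) z = 0 := by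
  have hd (z : E) : HasFDerivAt (fun z => u (c - t • z)) (-t • fderiv ℝ u (c - t • z)) z := by
    have := (hu.differentiable one_ne_zero (c - t • z)).hasFDerivAt.comp z
      (((hasFDerivAt_id z).const_smul t).const_sub c)
    convert! this using 1
    ext v
    simp
  have hdirac : dirac b A (fun z => u (c - t • z)) = 0 := by
    ext z
    have := congrFun hAu (c - t • z)
    simp only [dirac, Pi.zero_apply] at this
    simp [dirac, (hd z).fderiv, ← Finset.smul_sum, this]
  have hself := hw.integral_smul_fderiv_self b hA (u := fun z => u (c - t • z)) (by fun_prop) hdirac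
  simp_rw [(hd _).fderiv, _root_.smul_apply, smul_comm (w _) (-t), integral_smul] at hself
  exact (smul_eq_zero.1 hself).resolve_left (neg_ne_zero.2 ht)

theorem integral_smul_sub (hw : IsRadialWeight w w') (b : OrthonormalBasis ι ℝ E)
    (hA : FactorsNormSq A' A) (hu : ContDiff ℝ 1 u) (hAu : dirac b A u = 0) (c : E) :
    ∫ z, w z • u (c - z) = (∫ z, w z) • u c := by
  have hdu : Continuous fun q : ℝ × E => fderiv ℝ u (c - q.1 • q.2) q.2 := by
    have := hu.continuous_fderiv one_ne_zero
    fun_prop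
  have := hu.continuous
  have ftc (z : E) : ∫ t in (0 : ℝ)..1, w z • fderiv ℝ u (c - t • z) z =
      w z • u c - w z • u (c - z) := by
    have hd (t : ℝ) : HasDerivAt (fun t : ℝ => w z • u (c - t • z))
        (-(w z • fderiv ℝ u (c - t • z) z)) t := by
      have := ((hu.differentiable one_ne_zero (c - t • z)).hasFDerivAt.comp_hasDerivAt t
        (((hasDerivAt_id t).smul_const z).const_sub c)).const_smul (w z)
      simpa using! this
    have := intervalIntegral.integral_eq_sub_of_hasDerivAt (a := 0) (b := 1) (fun t _ => hd t)
      (((hdu.comp (.prodMk_left z)).const_smul (w z)).neg.intervalIntegrable 0 1)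
    rw [intervalIntegral.integral_neg, neg_eq_iff_eq_neg] at this
    simpa using this
  have swap : ∫ z, ∫ t in (0 : ℝ)..1, w z • fderiv ℝ u (c - t • z) z = 0 := by
    rw [← intervalIntegral_integral_swap_of_hasCompactSupport hw.continuous hw.hasCompactSupport
      (f := fun t z => fderiv ℝ u (c - t • z) z) hdu]
    refine intervalIntegral.integral_zero_ae (ae_of_all _ fun t ht => ?_)
    rw [uIoc_of_le zero_le_one] at ht
    exact hw.integral_smul_fderiv_sub_smul b hA hu hAu c ht.1.ne'
  simp_rw [ftc] at swap
  rw [integral_sub (hw.integrable_smul continuous_const) (hw.integrable_smul (by fun_prop)),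
    integral_smul_const, sub_eq_zero] at swap
  exact swap.symm

end IsRadialWeight

end MeanValue

section UniqueContinuation

open MeasureTheory Filter Topology Convolution

theorem hasDerivAt_max_zero_pow (k : ℕ) (t : ℝ) :
    HasDerivAt (fun t : ℝ => max t 0 ^ (k + 2)) ((k + 2) * max t 0 ^ (k + 1)) t := by
  refine hasDerivAt_of_hasDerivAt_of_ne' (x := 0) (g := fun t => (k + 2) * max t 0 ^ (k + 1))
    (fun y hy => ?_) (by fun_prop) (by fun_prop) t
  rcases lt_or_gt_of_ne hy with h | h
  · have : (fun t : ℝ => max t 0 ^ (k + 2)) =ᶠ[𝓝 y] fun _ => 0 := by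
      filter_upwards [gt_mem_nhds h] with z hz
      simp [max_eq_right hz.le]
    simpa [max_eq_right h.le] using (hasDerivAt_const y (0 : ℝ)).congr_of_eventuallyEq this
  · have : (fun t : ℝ => max t 0 ^ (k + 2)) =ᶠ[𝓝 y] fun t => t ^ (k + 2) := by
      filter_upwards [lt_mem_nhds h] with z hz
      simp [max_eq_left hz.le]
    simpa [max_eq_left h.le] using (hasDerivAt_pow (k + 2) y).congr_of_eventuallyEq this

variable {ι E V : Type*} [Fintype ι] [NormedAddCommGroup E]

/-- The truncated power `max (ρ - ‖z‖²) 0 ^ k`. Up to a constant, the gradient of the power `k + 1`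
at `z` is the power `k` times `z`. -/
def truncPow (ρ : ℝ) (k : ℕ) (z : E) : ℝ := max (ρ - ‖z‖ ^ 2) 0 ^ k

theorem continuous_truncPow (ρ : ℝ) (k : ℕ) : Continuous (truncPow ρ k : E → ℝ) := by
  unfold truncPow
  fun_prop

theorem truncPow_pos {ρ : ℝ} {k : ℕ} {z : E} (h : ‖z‖ ^ 2 < ρ) : 0 < truncPow ρ k z :=
  pow_pos (lt_max_of_lt_left (sub_pos.2 h)) _

variable [InnerProductSpace ℝ E] [NormedAddCommGroup V] [NormedSpace ℝ V]

theorem hasFDerivAt_truncPow (ρ : ℝ) (k : ℕ) (z : E) :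
    HasFDerivAt (truncPow ρ (k + 2) : E → ℝ)
      ((-2 * (k + 2) * truncPow ρ (k + 1) z) • innerSL ℝ z) z := by
  have h := (hasDerivAt_max_zero_pow k (ρ - ‖z‖ ^ 2)).comp_hasFDerivAt z
    ((hasStrictFDerivAt_norm_sq z).hasFDerivAt.const_sub ρ)
  convert! h using 1
  ext v
  simp [truncPow]
  ring

theorem contDiff_truncPow (ρ : ℝ) (k : ℕ) : ContDiff ℝ 1 (truncPow ρ (k + 2) : E → ℝ) := by
  rw [contDiff_one_iff_hasFDerivAt]
  have := continuous_truncPow (E := E) ρ (k + 1)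
  exact ⟨_, by fun_prop, hasFDerivAt_truncPow ρ k⟩

variable [FiniteDimensional ℝ E]

theorem hasCompactSupport_truncPow (ρ : ℝ) (k : ℕ) :
    HasCompactSupport (truncPow ρ (k + 1) : E → ℝ) := by
  refine HasCompactSupport.intro (isCompact_closedBall 0 √ρ) fun z hz => ?_
  rw [mem_closedBall_zero_iff, not_le] at hz
  simp [truncPow, max_eq_right (sub_nonpos.2 ((Real.sqrt_le_left (norm_nonneg _)).1 hz.le))]

theorem isRadialWeight_truncPow (ρ : ℝ) (k : ℕ) :
    IsRadialWeight (truncPow ρ (k + 2) : E → ℝ)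
      fun z => -2 * (k + 2) * truncPow ρ (k + 1) z where
  hasFDerivAt := hasFDerivAt_truncPow ρ k
  continuous_factor := (continuous_truncPow ρ (k + 1)).const_mul _
  hasCompactSupport := hasCompactSupport_truncPow ρ (k + 1)

variable [MeasurableSpace E] [BorelSpace E]

theorem integrable_truncPow_smul (ρ : ℝ) (k : ℕ) (c : E) {u : E → V} (hu : Continuous u) :
    Integrable fun y => truncPow ρ (k + 1) (c - y) • u y :=
  (((continuous_truncPow ρ _).comp (continuous_sub_left c)).smul hu).integrable_of_hasCompactSupport
    ((hasCompactSupport_truncPow ρ k).comp_homeomorph (Homeomorph.subLeft c)).smul_right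

/-- All averages of `u` around points of `U` with truncated powers as weights vanish. Unlike
vanishing on `U`, this is a nonlocal condition on `u`. -/
def RadiallyNull (U : Set E) (u : E → V) : Prop :=
  ∀ c ∈ U, ∀ ρ k, ∫ y, truncPow ρ (k + 2) (c - y) • u y = 0

namespace RadiallyNull

variable {U : Set E} {u u' : E → V}

theorem add (h : RadiallyNull U u) (h' : RadiallyNull U u') (hu : Continuous u)
    (hu' : Continuous u') : RadiallyNull U fun y => u y + u' y := by
  intro c hc ρ k
  simp only [smul_add]
  rw [integral_add (integrable_truncPow_smul ρ _ c hu) (integrable_truncPow_smul ρ _ c hu'),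
    h c hc, h' c hc, add_zero]

theorem const_smul (h : RadiallyNull U u) (a : ℝ) : RadiallyNull U fun y => a • u y := by
  intro c hc ρ k
  simp only [smul_comm _ a]
  rw [integral_smul, h c hc, smul_zero]

theorem integral_smul_inner_sub (h : RadiallyNull U u) (hU : IsOpen U) (hu : Continuous u)
    {c : E} (hc : c ∈ U) (ρ : ℝ) (k : ℕ) (v : E) :
    ∫ y, truncPow ρ (k + 2) (c - y) • inner ℝ v (c - y) • u y = 0 := by
  have hcs := hasCompactSupport_truncPow (E := E) ρ (k + 2)
  have hderiv := hcs.hasFDerivAt_convolution_right (ContinuousLinearMap.lsmul ℝ ℝ).flip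
    (μ := volume) hu.locallyIntegrable (contDiff_truncPow ρ (k + 1)) c
  have hconst : (convolution u (truncPow ρ (k + 3)) (ContinuousLinearMap.lsmul ℝ ℝ).flip volume)
      =ᶠ[𝓝 c] fun _ => 0 := by
    filter_upwards [hU.mem_nhds hc] with c' hc' using h c' hc' ρ (k + 1)
  have hzero := congrArg (fun L => L v)
    (hderiv.unique ((hasFDerivAt_const 0 c).congr_of_eventuallyEq hconst))
  simp only [_root_.zero_apply] at hzero
  rw [convolution_precompR_apply _ hu.locallyIntegrable (hcs.fderiv ℝ)
    ((contDiff_truncPow ρ (k + 1)).continuous_fderiv one_ne_zero), convolution_def] at hzero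
  simp only [ContinuousLinearMap.flip_apply, ContinuousLinearMap.lsmul_apply,
    (hasFDerivAt_truncPow ρ (k + 1) _).fderiv, _root_.smul_apply, innerSL_apply_apply, smul_eq_mul,
    mul_smul, integral_smul, smul_eq_zero, real_inner_comm v] at hzero
  have hk : ((k + 1 : ℕ) : ℝ) + 2 ≠ 0 := by positivity
  exact (hzero.resolve_left (by norm_num)).resolve_left hk

theorem inner_smul (h : RadiallyNull U u) (hU : IsOpen U) (hu : Continuous u) (v : E) :
    RadiallyNull U fun y => inner ℝ v y • u y := by
  intro c hc ρ k
  have split (y : E) : truncPow ρ (k + 2) (c - y) • inner ℝ v y • u y =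
      inner ℝ v c • truncPow ρ (k + 2) (c - y) • u y -
        truncPow ρ (k + 2) (c - y) • inner ℝ v (c - y) • u y := by
    rw [inner_sub_right]
    module
  simp_rw [split]
  rw [integral_sub ((integrable_truncPow_smul ρ _ c hu).fun_smul _)
      (integrable_truncPow_smul ρ _ c (by fun_prop)),
    integral_smul, h c hc, smul_zero, h.integral_smul_inner_sub hU hu hc, sub_zero]

end RadiallyNull

/-- The continuous functions multiplication by which preserves `RadiallyNull U`. -/
def nullMultipliers (V : Type*) [NormedAddCommGroup V] [NormedSpace ℝ V] (U : Set E) :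
    Subalgebra ℝ C(E, ℝ) where
  carrier := {P | ∀ u : E → V, Continuous u → RadiallyNull U u → RadiallyNull U fun y => P y • u y}
  mul_mem' {P Q} hP hQ u hu h := by
    simpa [mul_smul] using hP _ (Q.continuous.smul hu) (hQ u hu h)
  add_mem' {P Q} hP hQ u hu h := by
    simpa [add_smul] using
      (hP u hu h).add (hQ u hu h) (P.continuous.smul hu) (Q.continuous.smul hu)
  algebraMap_mem' a u _ h := by
    simpa using h.const_smul a

theorem separatesPoints_nullMultipliers {U : Set E} (hU : IsOpen U) :
    (nullMultipliers V U).SeparatesPoints := by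
  intro x y hxy
  refine ⟨_, ⟨⟨fun z => inner ℝ (x - y) z, by fun_prop⟩,
    fun u hu h => h.inner_smul hU hu (x - y), rfl⟩, fun h => hxy (sub_eq_zero.1 ?_)⟩
  rw [← inner_self_eq_zero (𝕜 := ℝ), inner_sub_right]
  exact sub_eq_zero.2 h

variable [CompleteSpace V]

/-- By the Stone–Weierstrass theorem, every test function is a uniform limit of elements of `S` on
the support of `h`. -/
theorem eq_zero_of_integral_subalgebra_smul_eq_zero {S : Subalgebra ℝ C(E, ℝ)}
    (hS : S.SeparatesPoints) {h : E → V} (hh : Continuous h) (hcs : HasCompactSupport h)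
    (hint : ∀ P ∈ S, ∫ y, P y • h y = 0) : h = 0 := by
  have hi (g : C(E, ℝ)) : Integrable fun y => g y • h y :=
    (g.continuous.smul hh).integrable_of_hasCompactSupport hcs.smul_left
  have approx (g : C(E, ℝ)) {ε : ℝ} (hε : 0 < ε) : ‖∫ y, g y • h y‖ ≤ ε * ∫ y, ‖h y‖ := by
    obtain ⟨P, hP, hPg⟩ :=
      ContinuousMap.exists_mem_subalgebra_near_continuous_of_isCompact_of_separatesPoints
        hS g hcs hε
    rw [← sub_zero (∫ y, _), ← hint P hP, ← integral_sub (hi g) (hi P), ← integral_const_mul]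
    refine norm_integral_le_of_norm_le
      ((hh.integrable_of_hasCompactSupport hcs).norm.const_mul ε) (ae_of_all _ fun y => ?_)
    rw [← sub_smul, norm_smul, norm_sub_rev]
    by_cases hy : y ∈ tsupport h
    · exact mul_le_mul_of_nonneg_right (hPg y hy).le (norm_nonneg _)
    · simp [image_eq_zero_of_notMem_tsupport hy]
  have orthogonal (g : C(E, ℝ)) : ∫ y, g y • h y = 0 := by
    have lim : Tendsto (fun ε => ε * ∫ y, ‖h y‖) (𝓝[>] 0) (𝓝 0) := by
      simpa using ((tendsto_id (x := 𝓝 (0 : ℝ))).mul_const (∫ y, ‖h y‖)).mono_left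
        nhdsWithin_le_nhds
    exact norm_le_zero_iff.1
      (ge_of_tendsto lim (eventually_mem_nhdsWithin.mono fun ε hε => approx g hε))
  refine (hh.ae_eq_iff_eq volume continuous_zero).1 ?_
  exact ae_eq_zero_of_integral_contDiff_smul_eq_zero hh.locallyIntegrable
    fun g hg _ => orthogonal ⟨g, hg.continuous⟩

theorem RadiallyNull.eq_zero {U : Set E} {u : E → V} (h : RadiallyNull U u) (hU : IsOpen U)
    (hne : U.Nonempty) (hu : Continuous u) : u = 0 := by
  obtain ⟨c, hc⟩ := hne
  ext x
  set ρ := ‖c - x‖ ^ 2 + 1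
  have hzero : (fun y => truncPow ρ 2 (c - y) • u y) = 0 := by
    refine eq_zero_of_integral_subalgebra_smul_eq_zero (separatesPoints_nullMultipliers (V := V) hU)
      (((continuous_truncPow ρ 2).comp (continuous_sub_left c)).smul hu)
      ((hasCompactSupport_truncPow ρ 1).comp_homeomorph (Homeomorph.subLeft c)).smul_right
      fun P hP => ?_
    simpa [smul_comm (P _)] using hP u hu h c hc ρ 0
  exact (smul_eq_zero.1 (congrFun hzero x)).resolve_left (truncPow_pos (lt_add_one _)).ne'

theorem radiallyNull_of_dirac_eq_zero (b : OrthonormalBasis ι ℝ E) {A A' : E →ₗ[ℝ] V →L[ℝ] V}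
    (hA : FactorsNormSq A' A) {u : E → V} (hu : ContDiff ℝ 1 u) (hAu : dirac b A u = 0) {U : Set E}
    (hU : Set.EqOn u 0 U) : RadiallyNull U u := by
  intro c hc ρ k
  rw [← integral_sub_left_eq_self _ volume c]
  simpa [hU hc] using (isRadialWeight_truncPow ρ k).integral_smul_sub b hA hu hAu c

theorem eq_zero_of_dirac_eq_zero (b : OrthonormalBasis ι ℝ E) {A A' : E →ₗ[ℝ] V →L[ℝ] V}
    (hA : FactorsNormSq A' A) {u : E → V} (hu : ContDiff ℝ 1 u) (hAu : dirac b A u = 0) {U : Set E}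
    (hU : IsOpen U) (hne : U.Nonempty) (h0 : Set.EqOn u 0 U) : u = 0 :=
  (radiallyNull_of_dirac_eq_zero b hA hu hAu h0).eq_zero hU hne hu.continuous

end UniqueContinuation

section EvolutionEquation

open Filter Topology ContDiff Laplacian

theorem hasFDerivAt_indicator {E V : Type*} [NormedAddCommGroup E] [NormedSpace ℝ E]
    [NormedAddCommGroup V] [NormedSpace ℝ V] {s : Set E} {f : E → V} (hf : Differentiable ℝ f)
    (h0 : Set.EqOn f 0 (frontier s)) (h1 : Set.EqOn (fderiv ℝ f) 0 (frontier s)) (y : E) :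
    HasFDerivAt (s.indicator f) (s.indicator (fderiv ℝ f) y) y := by
  by_cases hy : y ∈ frontier s
  · have hfy := (hf y).hasFDerivAt
    rw [h1 hy, hasFDerivAt_iff_isLittleO, h0 hy] at hfy
    rw [Set.indicator_apply_eq_zero.2 fun _ => h1 hy, hasFDerivAt_iff_isLittleO,
      Set.indicator_apply_eq_zero.2 fun _ => h0 hy]
    simp only [Pi.zero_apply, _root_.zero_apply, sub_zero] at hfy ⊢
    exact (Asymptotics.isBigO_of_le _ fun z => norm_indicator_le_norm_self f z).trans_isLittleO hfy
  by_cases hys : y ∈ s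
  · rw [Set.indicator_of_mem hys]
    have hint : s ∈ 𝓝 y :=
      mem_interior_iff_mem_nhds.1 (not_not.1 fun h => hy ⟨subset_closure hys, h⟩)
    exact (hf y).hasFDerivAt.congr_of_eventuallyEq
      (eventually_of_mem hint fun z hz => Set.indicator_of_mem hz f)
  · rw [Set.indicator_of_notMem hys]
    have hext : (closure s)ᶜ ∈ 𝓝 y :=
      isClosed_closure.isOpen_compl.mem_nhds fun h => hy ⟨h, fun h => hys (interior_subset h)⟩
    exact (hasFDerivAt_const 0 y).congr_of_eventuallyEq
      (eventually_of_mem hext fun z hz =>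
        Set.indicator_of_notMem (fun h => hz (subset_closure h)) f)

theorem contDiff_one_indicator {E V : Type*} [NormedAddCommGroup E] [NormedSpace ℝ E]
    [NormedAddCommGroup V] [NormedSpace ℝ V] {s : Set E} {f : E → V} (hf : ContDiff ℝ 1 f)
    (h0 : Set.EqOn f 0 (frontier s)) (h1 : Set.EqOn (fderiv ℝ f) 0 (frontier s)) :
    ContDiff ℝ 1 (s.indicator f) :=
  contDiff_one_iff_hasFDerivAt.2 ⟨_,
    continuous_indicator h1 (hf.continuous_fderiv one_ne_zero).continuousOn,
    hasFDerivAt_indicator (hf.differentiable one_ne_zero) h0 h1⟩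

variable {ι E V : Type*} [Fintype ι] [NormedAddCommGroup E] [InnerProductSpace ℝ E]
  [NormedAddCommGroup V] [NormedSpace ℝ V]

/-- Vectors of `E` act on `V` through the Clifford relation `v² = -‖v‖²`. -/
def IsCliffordAction (B : E →ₗ[ℝ] V →L[ℝ] V) : Prop :=
  ∀ v x, B v (B v x) = -(‖v‖ ^ 2 • x)

/-- `F` solves the evolution equation `∂ᵣ F = ∑ᵢ B(bᵢ) ∂ᵢ F` on `E × ℝ`. -/
def SolvesEvolution (b : OrthonormalBasis ι ℝ E) (B : E →ₗ[ℝ] V →L[ℝ] V) (F : E × ℝ → V) : Prop :=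
  ∀ y, fderiv ℝ F y (0, 1) = ∑ i, B (b i) (fderiv ℝ F y (b i, 0))

/-- The symbol `(v, t) ↦ t + B v` of the operator `∂ᵣ + ∑ᵢ B(bᵢ) ∂ᵢ`. -/
def evolutionSymbol (B : E →ₗ[ℝ] V →L[ℝ] V) : WithLp 2 (E × ℝ) →ₗ[ℝ] V →L[ℝ] V :=
  LinearMap.toSpanSingleton ℝ (V →L[ℝ] V) 1 ∘ₗ WithLp.sndₗ 2 ℝ E ℝ + B ∘ₗ WithLp.fstₗ 2 ℝ E ℝ

theorem evolutionSymbol_apply (B : E →ₗ[ℝ] V →L[ℝ] V) (w : WithLp 2 (E × ℝ)) (x : V) :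
    evolutionSymbol B w x = w.snd • x + B w.fst x := rfl

theorem IsCliffordAction.factorsNormSq {B : E →ₗ[ℝ] V →L[ℝ] V} (hB : IsCliffordAction B) :
    FactorsNormSq (evolutionSymbol B) (evolutionSymbol (-B)) := by
  intro w x
  simp only [evolutionSymbol_apply, LinearMap.neg_apply, _root_.neg_apply, map_add, map_neg,
    map_smul, hB w.fst x, WithLp.prod_norm_sq_eq_of_L2, Real.norm_eq_abs, sq_abs]
  module

theorem dirac_evolutionSymbol (b : OrthonormalBasis ι ℝ E) (B : E →ₗ[ℝ] V →L[ℝ] V)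
    (F : E × ℝ → V) (y : WithLp 2 (E × ℝ)) :
    dirac (b.prod (OrthonormalBasis.singleton (Fin 1) ℝ)) (evolutionSymbol B)
        (F ∘ WithLp.prodContinuousLinearEquiv 2 ℝ E ℝ) y =
      fderiv ℝ F y.ofLp (0, 1) + ∑ i, B (b i) (fderiv ℝ F y.ofLp (b i, 0)) := by
  have hfd (v : WithLp 2 (E × ℝ)) :
      fderiv ℝ (F ∘ WithLp.prodContinuousLinearEquiv 2 ℝ E ℝ) y v = fderiv ℝ F y.ofLp v.ofLp := by
    rw [ContinuousLinearEquiv.comp_right_fderiv]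
    rfl
  simp only [dirac, Fintype.sum_sum_type, hfd]
  simp [evolutionSymbol_apply, add_comm]

namespace SolvesEvolution

variable {b : OrthonormalBasis ι ℝ E} {B : E →ₗ[ℝ] V →L[ℝ] V} {F G : E × ℝ → V}

theorem sub (hF : SolvesEvolution b B F) (hG : SolvesEvolution b B G) (hF' : Differentiable ℝ F)
    (hG' : Differentiable ℝ G) : SolvesEvolution b B (F - G) := by
  intro y
  rw [fderiv_sub (hF' y) (hG' y)]
  simp [hF y, hG y]

theorem fderiv_eq_zero_of_initial (hF : SolvesEvolution b B F) (hF' : Differentiable ℝ F)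
    (h0 : ∀ x, F (x, 0) = 0) (x : E) : fderiv ℝ F (x, 0) = 0 := by
  have spatial (v : E) : fderiv ℝ F (x, 0) (v, 0) = 0 := by
    have hcomp := HasFDerivAt.comp (f := fun x : E => (x, (0 : ℝ))) x
      (hF' (x, 0)).hasFDerivAt (hasFDerivAt_prodMk_left x (0 : ℝ))
    have hconst : F ∘ (fun x => (x, (0 : ℝ))) = fun _ => 0 := funext h0
    rw [hconst] at hcomp
    simpa using congrArg (fun L => L v) (hcomp.unique (hasFDerivAt_const _ x))
  have temporal : fderiv ℝ F (x, 0) (0, 1) = 0 := by simp [hF (x, 0), spatial]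
  refine ContinuousLinearMap.ext fun ⟨v, t⟩ => ?_
  have split : (v, t) = (v, (0 : ℝ)) + t • ((0 : E), (1 : ℝ)) := by simp
  simp only [split, map_add, map_smul, spatial, temporal, smul_zero, add_zero, _root_.zero_apply]

variable [FiniteDimensional ℝ E] [CompleteSpace V]

theorem eq_zero_of_eqOn (hF : SolvesEvolution b B F) (hB : IsCliffordAction B)
    (hF' : ContDiff ℝ 1 F) {U : Set (E × ℝ)} (hU : IsOpen U) (hne : U.Nonempty)
    (h0 : Set.EqOn F 0 U) : F = 0 := by
  let L := WithLp.prodContinuousLinearEquiv 2 ℝ E ℝ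
  let _ : MeasurableSpace (WithLp 2 (E × ℝ)) := borel _
  have : BorelSpace (WithLp 2 (E × ℝ)) := ⟨rfl⟩
  have hFL : F ∘ L = 0 := by
    refine eq_zero_of_dirac_eq_zero (b.prod (OrthonormalBasis.singleton (Fin 1) ℝ))
      hB.factorsNormSq (hF'.comp L.contDiff) (funext fun y => ?_) (hU.preimage L.continuous)
      (hne.preimage L.surjective) fun y hy => h0 hy
    simp [L, dirac_evolutionSymbol, hF y.ofLp]
  exact L.surjective.injective_comp_right hFL

/-- Since `F` vanishes to first order on `r = 0`, cutting it off to `r ≥ 0` yields a solution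
vanishing on the open half-space `r < 0`. -/
theorem eq_zero_of_initial (hF : SolvesEvolution b B F) (hB : IsCliffordAction B)
    (hF' : ContDiff ℝ 1 F) (h0 : ∀ x, F (x, 0) = 0) : F = 0 := by
  have hdiff := hF'.differentiable one_ne_zero
  let s : Set (E × ℝ) := Prod.snd ⁻¹' Set.Ici 0
  have frontier_s {y : E × ℝ} (hy : y ∈ frontier s) : y = (y.1, 0) :=
    Prod.ext rfl (by simpa using! continuous_snd.frontier_preimage_subset _ hy)
  have hF0 : Set.EqOn F 0 (frontier s) := fun y hy => by rw [frontier_s hy]; exact h0 _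
  have hdF0 : Set.EqOn (fderiv ℝ F) 0 (frontier s) := fun y hy => by
    rw [frontier_s hy]
    exact hF.fderiv_eq_zero_of_initial hdiff h0 _
  have hcut : SolvesEvolution b B (s.indicator F) := by
    intro y
    rw [(hasFDerivAt_indicator hdiff hF0 hdF0 y).fderiv]
    by_cases hy : y ∈ s
    · simpa only [Set.indicator_of_mem hy] using hF y
    · simp [Set.indicator_of_notMem hy]
  have hcut0 : s.indicator F = 0 :=
    hcut.eq_zero_of_eqOn hB (contDiff_one_indicator hF' hF0 hdF0)
      (isOpen_Iio.preimage continuous_snd) ⟨(0, -1), by simp⟩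
      fun y (hy : y.2 < 0) => Set.indicator_of_notMem (s := s) (not_le.2 hy) F
  exact hF.eq_zero_of_eqOn hB hF' (isOpen_Ioi.preimage continuous_snd) ⟨(0, 1), by simp⟩
    fun y (hy : 0 < y.2) => by simpa [s, hy.le] using congrFun hcut0 y

end SolvesEvolution

theorem dirac_zero (b : OrthonormalBasis ι ℝ E) (B : E →ₗ[ℝ] V →L[ℝ] V) :
    dirac b B (0 : E → V) = 0 := by
  ext y
  simp [dirac]

theorem contDiff_dirac (b : OrthonormalBasis ι ℝ E) (B : E →ₗ[ℝ] V →L[ℝ] V) {u : E → V} {m n : ℕ∞ω}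
    (hu : ContDiff ℝ n u) (hmn : m + 1 ≤ n) : ContDiff ℝ m (dirac b B u) :=
  ContDiff.sum fun i _ =>
    (B (b i)).contDiff.comp ((hu.fderiv_right hmn).clm_apply contDiff_const)

theorem contDiff_dirac_iterate (b : OrthonormalBasis ι ℝ E) (B : E →ₗ[ℝ] V →L[ℝ] V) {f : E → V}
    (hf : ContDiff ℝ ∞ f) (n : ℕ) : ContDiff ℝ ∞ ((dirac b B)^[n] f) := by
  induction n with
  | zero => exact hf
  | succ n ih =>
    rw [Function.iterate_succ_apply']
    exact contDiff_dirac b B ih le_rfl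

theorem IsCliffordAction.dirac_dirac [FiniteDimensional ℝ E] {B : E →ₗ[ℝ] V →L[ℝ] V}
    (hB : IsCliffordAction B) (b : OrthonormalBasis ι ℝ E) {f : E → V} (hf : ContDiff ℝ 2 f) :
    dirac b B (dirac b B f) = -Δ f := by
  have factors : FactorsNormSq (-B) B := fun v x => by simp [hB v x]
  rw [← factors.dirac_dirac b hf]
  ext y
  simp [dirac]

theorem IsCliffordAction.dirac_iterate_two_mul [FiniteDimensional ℝ E] {B : E →ₗ[ℝ] V →L[ℝ] V}
    (hB : IsCliffordAction B) (b : OrthonormalBasis ι ℝ E) {f : E → V} (hf : ContDiff ℝ ∞ f)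
    (k : ℕ) : (dirac b B)^[2 * k] f = (fun g : E → V => -Δ g)^[k] f := by
  induction k with
  | zero => rfl
  | succ k ih =>
    rw [Function.iterate_succ_apply', ← ih, Nat.mul_succ, Function.iterate_succ_apply',
      Function.iterate_succ_apply']
    exact hB.dirac_dirac b (contDiff_infty.1 (contDiff_dirac_iterate b B hf _) 2)

/-- The exponential `exp(r T) f` of the operator `T = ∑ᵢ B(bᵢ) ∂ᵢ`, as a function of `(x, r)`. -/
def diracExp (b : OrthonormalBasis ι ℝ E) (B : E →ₗ[ℝ] V →L[ℝ] V) (f : E → V) (y : E × ℝ) : V :=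
  ∑' n : ℕ, (y.2 ^ n / (n.factorial : ℝ)) • (dirac b B)^[n] f y.1

theorem hasDerivAt_pow_div_factorial (n : ℕ) (r : ℝ) :
    HasDerivAt (fun r : ℝ => r ^ (n + 1) / ((n + 1).factorial : ℝ)) (r ^ n / (n.factorial : ℝ))
      r := by
  refine ((hasDerivAt_pow (n + 1) r).div_const _).congr_deriv ?_
  rw [Nat.factorial_succ]
  push_cast
  field_simp

theorem hasFDerivAt_separated {c : ℝ → ℝ} {c' : ℝ} {g : E → V} {y : E × ℝ}
    (hc : HasDerivAt c c' y.2) (hg : DifferentiableAt ℝ g y.1) :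
    HasFDerivAt (fun y : E × ℝ => c y.2 • g y.1)
      (c y.2 • fderiv ℝ g y.1 ∘L ContinuousLinearMap.fst ℝ E ℝ +
        (c' • ContinuousLinearMap.snd ℝ E ℝ).smulRight (g y.1)) y :=
  (hc.comp_hasFDerivAt y hasFDerivAt_snd).fun_smul (hg.hasFDerivAt.comp y hasFDerivAt_fst)

section Nilpotent

variable {b : OrthonormalBasis ι ℝ E} {B : E →ₗ[ℝ] V →L[ℝ] V} {f : E → V} {N : ℕ}

theorem dirac_iterate_eq_zero_of_le (hN : (dirac b B)^[N] f = 0) {n : ℕ} (hn : N ≤ n) :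
    (dirac b B)^[n] f = 0 := by
  rw [← Nat.sub_add_cancel hn, Function.iterate_add_apply, hN]
  exact Function.iterate_fixed (dirac_zero b B) _

theorem hasFiniteSupport_diracExp (hN : (dirac b B)^[N] f = 0) (y : E × ℝ) :
    Function.HasFiniteSupport fun n : ℕ =>
      (y.2 ^ n / (n.factorial : ℝ)) • (dirac b B)^[n] f y.1 :=
  (Set.finite_Iio N).subset fun _ hn =>
    Set.mem_Iio.2 <| lt_of_not_ge fun hNn => hn (by simp [dirac_iterate_eq_zero_of_le hN hNn])

theorem diracExp_eq_tsum_even_add_odd (hN : (dirac b B)^[N] f = 0) (y : E × ℝ) :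
    diracExp b B f y =
      ∑' k : ℕ, (y.2 ^ (2 * k) / ((2 * k).factorial : ℝ)) • (dirac b B)^[2 * k] f y.1 +
      ∑' k : ℕ, (y.2 ^ (2 * k + 1) / ((2 * k + 1).factorial : ℝ)) •
        (dirac b B)^[2 * k + 1] f y.1 := by
  have even_injective : Function.Injective fun k : ℕ => 2 * k := mul_right_injective₀ two_ne_zero
  have odd_injective : Function.Injective fun k : ℕ => 2 * k + 1 :=
    (add_left_injective 1).comp even_injective
  have hfin := hasFiniteSupport_diracExp hN y
  exact (tsum_even_add_odd (f := fun n => (y.2 ^ n / (n.factorial : ℝ)) • (dirac b B)^[n] f y.1)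
    (summable_of_hasFiniteSupport (hfin.comp_of_injective even_injective))
    (summable_of_hasFiniteSupport (hfin.comp_of_injective odd_injective))).symm

theorem diracExp_eq_sum (hN : (dirac b B)^[N] f = 0) (y : E × ℝ) :
    diracExp b B f y =
      ∑ n ∈ Finset.range N, (y.2 ^ n / (n.factorial : ℝ)) • (dirac b B)^[n] f y.1 :=
  tsum_eq_sum fun n hn => by
    simp [dirac_iterate_eq_zero_of_le hN (not_lt.1 (mt Finset.mem_range.2 hn))]

theorem contDiff_diracExp (hf : ContDiff ℝ ∞ f) (hN : (dirac b B)^[N] f = 0) :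
    ContDiff ℝ ∞ (diracExp b B f) := by
  rw [funext (diracExp_eq_sum hN)]
  have := contDiff_dirac_iterate b B hf
  fun_prop

theorem fderiv_diracExp (hf : ContDiff ℝ ∞ f) (hN : (dirac b B)^[N] f = 0) (y w : E × ℝ) :
    fderiv ℝ (diracExp b B f) y w = ∑ n ∈ Finset.range N,
      ((y.2 ^ n / (n.factorial : ℝ)) • fderiv ℝ ((dirac b B)^[n] f) y.1 w.1 +
        (deriv (fun r : ℝ => r ^ n / (n.factorial : ℝ)) y.2 * w.2) • (dirac b B)^[n] f y.1) := by
  have hc (n : ℕ) : DifferentiableAt ℝ (fun r : ℝ => r ^ n / (n.factorial : ℝ)) y.2 := by fun_prop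
  have hsum := HasFDerivAt.fun_sum fun n (_ : n ∈ Finset.range N) =>
    hasFDerivAt_separated (hc n).hasDerivAt
      ((contDiff_dirac_iterate b B hf n).differentiable (by simp) y.1)
  rw [funext (diracExp_eq_sum hN), hsum.fderiv]
  simp

theorem solvesEvolution_diracExp (hf : ContDiff ℝ ∞ f) (hN : (dirac b B)^[N] f = 0) :
    SolvesEvolution b B (diracExp b B f) := by
  intro y
  have temporal : fderiv ℝ (diracExp b B f) y (0, 1) = ∑ n ∈ Finset.range N,
      deriv (fun r : ℝ => r ^ n / (n.factorial : ℝ)) y.2 • (dirac b B)^[n] f y.1 := by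
    simp [fderiv_diracExp hf hN]
  have spatial : ∑ i, B (b i) (fderiv ℝ (diracExp b B f) y (b i, 0)) = ∑ n ∈ Finset.range N,
      deriv (fun r : ℝ => r ^ (n + 1) / ((n + 1).factorial : ℝ)) y.2 •
        (dirac b B)^[n + 1] f y.1 := by
    simp only [fderiv_diracExp hf hN, (hasDerivAt_pow_div_factorial _ _).deriv, mul_zero, zero_smul,
      add_zero, map_sum, map_smul, Function.iterate_succ_apply', dirac, Finset.smul_sum]
    exact Finset.sum_comm
  rw [temporal, spatial, ← sub_eq_zero, ← Finset.sum_sub_distrib, Finset.sum_range_sub', hN]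
  simp

end Nilpotent

end EvolutionEquation

section Polynomials

open ContDiff

variable {E V W : Type*} [NormedAddCommGroup E] [NormedSpace ℝ E] [NormedAddCommGroup V]
  [NormedSpace ℝ V] [NormedAddCommGroup W] [NormedSpace ℝ W]

/-- `f` is a polynomial map of degree less than `n`, expressed as the vanishing of the `n`-th
derivative of a smooth map. -/
def HasDegreeLT (n : ℕ) (f : E → V) : Prop := ContDiff ℝ ∞ f ∧ iteratedFDeriv ℝ n f = 0

namespace HasDegreeLT

variable {m n : ℕ} {f g : E → V}

theorem succ_iff : HasDegreeLT (n + 1) f ↔ ContDiff ℝ ∞ f ∧ HasDegreeLT n (fderiv ℝ f) := by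
  have vanish_iff : iteratedFDeriv ℝ (n + 1) f = 0 ↔ iteratedFDeriv ℝ n (fderiv ℝ f) = 0 := by
    simp only [funext_iff, Pi.zero_apply]
    exact forall_congr' fun x => by
      rw [← norm_eq_zero, ← norm_iteratedFDeriv_fderiv, norm_eq_zero]
  simp only [HasDegreeLT, vanish_iff]
  exact ⟨fun h => ⟨h.1, h.1.fderiv_right le_rfl, h.2⟩, fun h => ⟨h.1, h.2.2⟩⟩

theorem eq_zero (h : HasDegreeLT 0 f) : f = 0 := by
  ext x
  rw [Pi.zero_apply, ← norm_eq_zero, ← norm_iteratedFDeriv_zero (𝕜 := ℝ), h.2]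
  simp

theorem mono (h : HasDegreeLT m f) (hmn : m ≤ n) : HasDegreeLT n f := by
  refine ⟨h.1, ?_⟩
  induction n, hmn using Nat.le_induction with
  | base => exact h.2
  | succ n _ ih =>
    rw [iteratedFDeriv_succ_eq_comp_left, ih]
    ext
    simp

theorem const (v : V) : HasDegreeLT 1 fun _ : E => v :=
  ⟨contDiff_const, iteratedFDeriv_succ_const 0 v⟩

theorem continuousLinearMap (L : E →L[ℝ] V) : HasDegreeLT 2 L := by
  refine succ_iff.2 ⟨L.contDiff, ?_⟩
  rw [show fderiv ℝ L = fun _ => L from funext fun _ => L.fderiv]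
  exact const L

theorem clm_comp (h : HasDegreeLT n f) (L : V →L[ℝ] W) : HasDegreeLT n (L ∘ f) := by
  refine ⟨L.contDiff.comp h.1, ?_⟩
  ext x : 1
  rw [L.iteratedFDeriv_comp_left h.1.contDiffAt (by exact_mod_cast le_top), h.2]
  ext
  simp

theorem add (hf : HasDegreeLT m f) (hg : HasDegreeLT n g) : HasDegreeLT (max m n) (f + g) := by
  refine ⟨hf.1.add hg.1, ?_⟩
  rw [iteratedFDeriv_add (hf.1.of_le (by exact_mod_cast le_top))
    (hg.1.of_le (by exact_mod_cast le_top)), (hf.mono (le_max_left m n)).2,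
    (hg.mono (le_max_right m n)).2, add_zero]

theorem mul {f g : E → ℝ} (hf : HasDegreeLT m f) (hg : HasDegreeLT n g) :
    HasDegreeLT (m + n) (f * g) := by
  refine ⟨hf.1.mul hg.1, funext fun x => norm_le_zero_iff.1 ?_⟩
  refine (norm_iteratedFDeriv_mul_le hf.1 hg.1 x (by exact_mod_cast le_top)).trans_eq
    (Finset.sum_eq_zero fun i _ => ?_)
  rcases le_or_gt m i with h | h
  · simp [(hf.mono h).2]
  · simp [(hg.mono (show n ≤ m + n - i by omega)).2]

protected theorem dirac {ι E : Type*} [Fintype ι] [NormedAddCommGroup E] [InnerProductSpace ℝ E]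
    {f : E → V} (h : HasDegreeLT (n + 1) f) (b : OrthonormalBasis ι ℝ E) (B : E →ₗ[ℝ] V →L[ℝ] V) :
    HasDegreeLT n (dirac b B f) := by
  convert! (succ_iff.1 h).2.clm_comp (∑ i, B (b i) ∘L ContinuousLinearMap.apply ℝ V (b i)) using 1
  ext y
  simp [OctonionCK.dirac]

theorem dirac_iterate_eq_zero {ι E : Type*} [Fintype ι] [NormedAddCommGroup E]
    [InnerProductSpace ℝ E] {f : E → V} (h : HasDegreeLT n f) (b : OrthonormalBasis ι ℝ E)
    (B : E →ₗ[ℝ] V →L[ℝ] V) : (dirac b B)^[n] f = 0 := by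
  induction n generalizing f with
  | zero => exact h.eq_zero
  | succ n ih => exact ih (h.dirac b B)

theorem mvPolynomial_eval {ι : Type*} [Fintype ι] (P : MvPolynomial ι ℝ) :
    ∃ n, HasDegreeLT n fun x : EuclideanSpace ℝ ι => MvPolynomial.eval (fun i => x i) P := by
  induction P using MvPolynomial.induction_on with
  | C a => exact ⟨1, by simpa using const a⟩
  | add P Q hP hQ =>
    obtain ⟨m, hm⟩ := hP
    obtain ⟨n, hn⟩ := hQ
    exact ⟨max m n, by simpa using! hm.add hn⟩
  | mul_X P i hP =>
    obtain ⟨m, hm⟩ := hP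
    exact ⟨m + 2, by
      simpa using! hm.mul (continuousLinearMap (EuclideanSpace.proj (𝕜 := ℝ) i))⟩

theorem of_components {κ : Type*} [Fintype κ] {f : E → EuclideanSpace ℝ κ}
    (h : ∀ j, HasDegreeLT n fun x => f x j) : HasDegreeLT n f := by
  have hf : ContDiff ℝ ∞ f := contDiff_euclidean.2 fun j => (h j).1
  refine ⟨hf, ?_⟩
  ext x v j
  have hj := (EuclideanSpace.proj (𝕜 := ℝ) j).iteratedFDeriv_comp_left (x := x) hf.contDiffAt
    (i := n) (by exact_mod_cast le_top)
  have h0 : iteratedFDeriv ℝ n (EuclideanSpace.proj (𝕜 := ℝ) j ∘ f) = 0 := (h j).2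
  rw [h0] at hj
  exact (congrArg (fun M => M v) hj).symm

end HasDegreeLT

end Polynomials

section OctonionAlgebra

theorem mul_apply (x y : Octonion) (k : Fin 8) :
    (x * y) k = ∑ i, ∑ j, (octConst i j k : ℝ) * (x i * y j) := rfl

instance : NonUnitalNonAssocRing Octonion where
  left_distrib x y z := by
    ext k
    simp only [mul_apply, PiLp.add_apply, mul_add, Finset.sum_add_distrib]
  right_distrib x y z := by
    ext k
    simp only [mul_apply, PiLp.add_apply, add_mul, mul_add, Finset.sum_add_distrib]
  zero_mul x := by
    ext k
    simp [mul_apply]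
  mul_zero := mul_zero_oct

instance : IsScalarTower ℝ Octonion Octonion where
  smul_assoc a x y := by
    ext k
    simp only [smul_eq_mul, mul_apply, PiLp.smul_apply, Finset.mul_sum]
    exact Finset.sum_congr rfl fun i _ => Finset.sum_congr rfl fun j _ => by ring

instance : SMulCommClass ℝ Octonion Octonion where
  smul_comm a x y := by
    ext k
    simp only [smul_eq_mul, mul_apply, PiLp.smul_apply, Finset.mul_sum]
    exact Finset.sum_congr rfl fun i _ => Finset.sum_congr rfl fun j _ => by ring

/-- The sign of the conjugate of the basis octonion `e i`. -/
def conjSign (i : Fin 8) : ℤ := if i = 0 then 1 else -1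

/-- Octonion conjugation. -/
def conj (x : Octonion) : Octonion := WithLp.toLp 2 fun i => conjSign i * x i

theorem conj_apply (x : Octonion) (i : Fin 8) : conj x i = conjSign i * x i := rfl

theorem conj_conj (x : Octonion) : conj (conj x) = x := by
  ext i
  by_cases h : i = 0 <;> simp [conj_apply, conjSign, h]

theorem inner_conj_left (x y : Octonion) : inner ℝ (conj x) y = inner ℝ x (conj y) := by
  simp only [PiLp.inner_apply, conj_apply, RCLike.inner_apply, conj_trivial]
  exact Finset.sum_congr rfl fun i _ => by ring

/-- The identity `conj a * (b * x) + conj b * (a * x) = 2 ⟪a, b⟫ x` in coordinates. -/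
theorem sum_conjSign_mul_octConst : ∀ i j l k : Fin 8,
    ∑ m, (conjSign i * octConst j l m * octConst i m k
      + conjSign j * octConst i l m * octConst j m k)
      = if i = j ∧ l = k then 2 else 0 := by
  decide +kernel

theorem conj_mul_mul_apply (a b x : Octonion) (k : Fin 8) :
    (conj a * (b * x)) k = ∑ i, ∑ j, ∑ l, a i * b j * x l *
      ((∑ m, conjSign i * octConst j l m * octConst i m k : ℤ) : ℝ) := by
  simp only [mul_apply, conj_apply]
  refine Finset.sum_congr rfl fun i _ => ?_
  simp only [Finset.mul_sum, Int.cast_sum]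
  rw [Finset.sum_comm]
  refine Finset.sum_congr rfl fun j _ => ?_
  rw [Finset.sum_comm]
  refine Finset.sum_congr rfl fun l _ => Finset.sum_congr rfl fun m _ => ?_
  push_cast
  ring

theorem conj_mul_mul_add_conj_mul_mul (a b x : Octonion) :
    conj a * (b * x) + conj b * (a * x) = (2 * inner ℝ a b) • x := by
  ext k
  have swapped : (conj b * (a * x)) k = ∑ i, ∑ j, ∑ l, a i * b j * x l *
      ((∑ m, conjSign j * octConst i l m * octConst j m k : ℤ) : ℝ) := by
    rw [conj_mul_mul_apply, Finset.sum_comm]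
    exact Finset.sum_congr rfl fun i _ => Finset.sum_congr rfl fun j _ =>
      Finset.sum_congr rfl fun l _ => by ring
  rw [PiLp.add_apply, conj_mul_mul_apply, swapped]
  simp only [← Finset.sum_add_distrib, ← mul_add, ← Int.cast_add, sum_conjSign_mul_octConst]
  simp only [ite_and, Int.cast_ite, Int.cast_ofNat, Int.cast_zero, mul_ite, mul_zero,
    Finset.sum_ite_irrel, Finset.sum_const_zero, Finset.sum_ite_eq, Finset.sum_ite_eq',
    Finset.mem_univ, if_true, PiLp.smul_apply, PiLp.inner_apply, smul_eq_mul, Finset.mul_sum,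
    Finset.sum_mul]
  exact Finset.sum_congr rfl fun i _ => by
    simp only [RCLike.inner_apply, conj_trivial]
    ring

theorem conj_mul_mul_self (a x : Octonion) : conj a * (a * x) = ‖a‖ ^ 2 • x := by
  have h := conj_mul_mul_add_conj_mul_mul a a x
  rw [real_inner_self_eq_norm_sq, ← two_smul ℝ, mul_smul] at h
  exact smul_right_injective _ two_ne_zero h

/-- Left multiplication in the octonions as a family of continuous linear maps. -/
def mulL : Octonion →ₗ[ℝ] Octonion →L[ℝ] Octonion :=
  LinearMap.toContinuousLinearMap.toLinearMap ∘ₗ LinearMap.mul ℝ Octonion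

theorem mulL_apply (x y : Octonion) : mulL x y = x * y := rfl

end OctonionAlgebra

section Slices

variable {p : Fin 7}

theorem emb_single (i : Fin ((p : ℕ) + 1)) : emb p (EuclideanSpace.single i 1) = e (idx p i) := by
  simp [emb, ite_smul]

theorem emb_apply_eq_zero (v : Base p) {i : Fin 8} (hi : (p : ℕ) < i) : emb p v i = 0 := by
  simp only [emb, e, WithLp.ofLp_sum, WithLp.ofLp_smul, Finset.sum_apply, Pi.smul_apply]
  refine Finset.sum_eq_zero fun j _ => ?_
  have hij : i ≠ idx p j := fun h => by
    subst h
    simp [idx] at hi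
    omega
  simp [hij]

theorem orthonormal_e_idx (p : Fin 7) : Orthonormal ℝ fun i => e (idx p i) := by
  simpa [Function.comp_def] using! (EuclideanSpace.basisFun (Fin 8) ℝ).orthonormal.comp (idx p)
    (Fin.castLE_injective (by omega))

theorem norm_emb (v : Base p) : ‖emb p v‖ = ‖v‖ := by
  rw [← sq_eq_sq₀ (norm_nonneg _) (norm_nonneg _), ← real_inner_self_eq_norm_sq, emb,
    (orthonormal_e_idx p).inner_sum, EuclideanSpace.norm_sq_eq]
  exact Finset.sum_congr rfl fun i _ => by simp [sq]

/-- The inclusion `ℝ^{p+1} ⊆ 𝕆` as a linear map. -/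
def embₗ (p : Fin 7) : Base p →ₗ[ℝ] Octonion where
  toFun := emb p
  map_add' x y := by simp [emb, add_smul, Finset.sum_add_distrib]
  map_smul' a x := by simp [emb, mul_smul, Finset.smul_sum]

variable {ω : Octonion}

theorem conj_of_mem_sphere (hω : ω ∈ sphere p) : conj ω = -ω := by
  ext i
  by_cases h : i = 0
  · simp [conj_apply, h, hω.1 0 (Nat.zero_le _)]
  · simp [conj_apply, conjSign, h]

theorem neg_mem_sphere (hω : ω ∈ sphere p) : -ω ∈ sphere p :=
  ⟨fun i hi => by simp [hω.1 i hi], by rw [norm_neg, hω.2]⟩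

theorem mul_mul_of_mem_sphere (hω : ω ∈ sphere p) (x : Octonion) : ω * (ω * x) = -x := by
  have h := conj_mul_mul_self ω x
  rw [conj_of_mem_sphere hω, hω.2, neg_mul, one_pow, one_smul] at h
  exact neg_eq_iff_eq_neg.1 h

theorem inner_emb_of_mem_sphere (hω : ω ∈ sphere p) (v : Base p) : inner ℝ (emb p v) ω = 0 := by
  rw [PiLp.inner_apply]
  refine Finset.sum_eq_zero fun i _ => ?_
  rcases le_or_gt (i : ℕ) p with h | h
  · simp [hω.1 i h]
  · simp [emb_apply_eq_zero v h]

theorem emb_mul_mul_of_mem_sphere (hω : ω ∈ sphere p) (v : Base p) (x : Octonion) :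
    emb p v * (ω * x) = ω * (conj (emb p v) * x) := by
  have h := conj_mul_mul_add_conj_mul_mul (conj (emb p v)) ω x
  rw [inner_conj_left, conj_conj, conj_of_mem_sphere hω, inner_neg_right,
    inner_emb_of_mem_sphere hω, neg_mul, neg_zero, mul_zero, zero_smul] at h
  exact add_neg_eq_zero.1 h

theorem exists_slice_eq (p : Fin 7) (z : Octonion) : ∃ ω ∈ sphere p, ∃ y, slice p ω y = z := by
  have split : emb p (basePart p z) + restPart p z = z := add_sub_cancel _ _
  by_cases hr : restPart p z = 0
  · refine ⟨e 7, ⟨fun i hi => ?_, by simp [e]⟩, (basePart p z, 0), ?_⟩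
    · have hi7 : i ≠ 7 := fun h => by
        subst h
        exact absurd p.isLt (not_lt.2 hi)
      simp [e, hi7]
    · simpa [slice, hr] using split
  · have hn : ‖restPart p z‖ ≠ 0 := norm_ne_zero_iff.2 hr
    refine ⟨‖restPart p z‖⁻¹ • restPart p z, ⟨fun i hi => ?_, ?_⟩,
      (basePart p z, ‖restPart p z‖), ?_⟩
    · have hi0 : restPart p z i = 0 := by
        rw [restPart, PiLp.sub_apply, show i = idx p ⟨i, by omega⟩ from rfl, emb_apply]
        exact sub_self _
      simp [hi0]
    · rw [norm_smul, norm_inv, norm_norm, inv_mul_cancel₀ hn]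
    · rw [slice, smul_inv_smul₀ hn, split]

end Slices

section SliceEquation

variable {p : Fin 7} {ω : Octonion}

/-- The action `v ↦ ω (v ·)` of `ℝ^{p+1}` on the octonions; for `ω ∈ 𝕊` it turns `D_ω F = 0` into
an evolution equation solved for `∂_r F`. -/
def sliceSymbol (p : Fin 7) (ω : Octonion) : Base p →ₗ[ℝ] Octonion →L[ℝ] Octonion :=
  (ContinuousLinearMap.compL ℝ Octonion Octonion Octonion (mulL ω)).toLinearMap ∘ₗ mulL ∘ₗ embₗ p

theorem sliceSymbol_apply (v : Base p) (x : Octonion) :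
    sliceSymbol p ω v x = ω * (emb p v * x) := rfl

theorem isCliffordAction_sliceSymbol (hω : ω ∈ sphere p) :
    IsCliffordAction (sliceSymbol p ω) := fun v x => by
  rw [sliceSymbol_apply, sliceSymbol_apply, emb_mul_mul_of_mem_sphere hω, conj_mul_mul_self,
    norm_emb, mul_mul_of_mem_sphere hω]

theorem mul_sliceD (hω : ω ∈ sphere p) (F : Base p × ℝ → Octonion) (y : Base p × ℝ) :
    ω * sliceD p ω F y =
      ∑ i, sliceSymbol p ω (EuclideanSpace.basisFun _ ℝ i)
        (fderiv ℝ F y (EuclideanSpace.basisFun _ ℝ i, 0)) - fderiv ℝ F y (0, 1) := by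
  simp only [sliceD, mul_add, Finset.mul_sum, mul_mul_of_mem_sphere hω, sliceSymbol_apply,
    EuclideanSpace.basisFun_apply, emb_single, sub_eq_add_neg]

theorem solvesEvolution_sliceSymbol_iff (hω : ω ∈ sphere p) {F : Base p × ℝ → Octonion} :
    SolvesEvolution (EuclideanSpace.basisFun _ ℝ) (sliceSymbol p ω) F ↔
      ∀ y, sliceD p ω F y = 0 := by
  refine forall_congr' fun y => ?_
  have mul_eq_zero_iff (z : Octonion) : ω * z = 0 ↔ z = 0 :=
    ⟨fun h => by rw [← neg_eq_zero, ← mul_mul_of_mem_sphere hω, h, mul_zero],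
      fun h => by rw [h, mul_zero]⟩
  rw [← mul_eq_zero_iff, mul_sliceD hω, sub_eq_zero, eq_comm]

theorem dirac_sliceSymbol (f : Base p → Octonion) :
    dirac (EuclideanSpace.basisFun _ ℝ) (sliceSymbol p ω) f = mulL ω ∘ baseD p f := by
  ext1 x
  simp only [dirac, sliceSymbol_apply, EuclideanSpace.basisFun_apply, emb_single,
    Function.comp_apply, mulL_apply, baseD, Finset.mul_sum]

/-- Left multiplication by `ω ∈ 𝕊`, whose inverse is left multiplication by `-ω`. -/
def mulLeftEquiv (hω : ω ∈ sphere p) : Octonion ≃L[ℝ] Octonion :=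
  ContinuousLinearEquiv.equivOfInverse (mulL ω) (mulL (-ω))
    (fun x => by rw [mulL_apply, mulL_apply, neg_mul, mul_mul_of_mem_sphere hω, neg_neg])
    (fun x => by rw [mulL_apply, mulL_apply, neg_mul, mul_neg, mul_mul_of_mem_sphere hω, neg_neg])

theorem mulLeftEquiv_apply (hω : ω ∈ sphere p) (x : Octonion) : mulLeftEquiv hω x = ω * x := rfl

theorem negLaplacianPow_mulLeftEquiv_comp (hω : ω ∈ sphere p) (k : ℕ) (f : Base p → Octonion) :
    negLaplacianPow p k (mulLeftEquiv hω ∘ f) = mulLeftEquiv hω ∘ negLaplacianPow p k f := by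
  refine (Function.Semiconj.iterate_right (f := fun g => mulLeftEquiv hω ∘ g) ?_ k f).symm
  intro g
  ext1 x
  simp [InnerProductSpace.laplacian_CLE_comp_left]

section DiracIterate

variable {f : Base p → Octonion}

theorem dirac_iterate_even (hω : ω ∈ sphere p) (hf : ContDiff ℝ (⊤ : ℕ∞) f) (k : ℕ) :
    (dirac (EuclideanSpace.basisFun _ ℝ) (sliceSymbol p ω))^[2 * k] f = negLaplacianPow p k f :=
  (isCliffordAction_sliceSymbol hω).dirac_iterate_two_mul _ hf k

theorem dirac_iterate_odd (hω : ω ∈ sphere p) (hf : ContDiff ℝ (⊤ : ℕ∞) f) (k : ℕ) :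
    (dirac (EuclideanSpace.basisFun _ ℝ) (sliceSymbol p ω))^[2 * k + 1] f =
      mulLeftEquiv hω ∘ negLaplacianPow p k (baseD p f) := by
  rw [Function.iterate_succ_apply, dirac_iterate_even hω (contDiff_dirac _ _ hf le_rfl),
    dirac_sliceSymbol, ← negLaplacianPow_mulLeftEquiv_comp]
  rfl

theorem ckSeries_eq_diracExp (hω : ω ∈ sphere p) (hf : ContDiff ℝ (⊤ : ℕ∞) f) {N : ℕ}
    (hN : (dirac (EuclideanSpace.basisFun _ ℝ) (sliceSymbol p ω))^[N] f = 0) (y : Base p × ℝ) :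
    ckSeries p f y.1 y.2 ω =
      diracExp (EuclideanSpace.basisFun _ ℝ) (sliceSymbol p ω) f y := by
  rw [ckSeries, ← mulLeftEquiv_apply hω, ContinuousLinearEquiv.map_tsum,
    diracExp_eq_tsum_even_add_odd hN]
  simp only [dirac_iterate_even hω hf, dirac_iterate_odd hω hf, Function.comp_apply, map_smul]

end DiracIterate

end SliceEquation

section Extension

variable {p : Fin 7}

theorem IsPolynomialMap.exists_hasDegreeLT {f : Base p → Octonion} (hf : IsPolynomialMap p f) :
    ∃ n, HasDegreeLT n f := by
  choose P hP using hf
  choose n hn using fun j => HasDegreeLT.mvPolynomial_eval (P j)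
  exact ⟨∑ j, n j, .of_components fun j => by
    simpa only [hP] using
      (hn j).mono (Finset.single_le_sum_of_canonicallyOrdered (Finset.mem_univ j))⟩

theorem ckSeries_neg (p : Fin 7) (f : Base p → Octonion) (x : Base p) (r : ℝ) (ω : Octonion) :
    ckSeries p f x (-r) (-ω) = ckSeries p f x r ω := by
  have even_pow (k : ℕ) : (-r) ^ (2 * k) = r ^ (2 * k) := (even_two_mul k).neg_pow r
  have odd_pow (k : ℕ) : (-r) ^ (2 * k + 1) = -r ^ (2 * k + 1) := (odd_two_mul_add_one k).neg_pow r
  simp only [ckSeries, even_pow, odd_pow, neg_div, neg_smul, tsum_neg, neg_mul_neg]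

theorem CK_comp_slice (p : Fin 7) (f : Base p → Octonion) {ω : Octonion} (hω : ω ∈ sphere p) :
    CK p f ∘ slice p ω = fun y => ckSeries p f y.1 y.2 ω := by
  funext ⟨x, r⟩
  rcases le_total 0 r with hr | hr
  · exact CK_slice p f hω x hr
  · have slice_neg : slice p ω (x, r) = slice p (-ω) (x, -r) := by simp [slice]
    rw [Function.comp_apply, slice_neg, CK_slice p f (neg_mem_sphere hω) x (neg_nonneg.2 hr),
      ckSeries_neg]

theorem isGSM_univ_iff {f : Octonion → Octonion} :
    IsGSM p Set.univ f ↔ ∀ ω ∈ sphere p, ContDiff ℝ 1 (f ∘ slice p ω) ∧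
      SolvesEvolution (EuclideanSpace.basisFun _ ℝ) (sliceSymbol p ω) (f ∘ slice p ω) := by
  refine forall₂_congr fun ω hω => ?_
  simp [solvesEvolution_sliceSymbol_iff hω, contDiffOn_univ]

theorem isGSM_CK {f : Base p → Octonion} (hf : IsPolynomialMap p f) :
    IsGSM p Set.univ (CK p f) := by
  obtain ⟨n, hn⟩ := hf.exists_hasDegreeLT
  refine isGSM_univ_iff.2 fun ω hω => ?_
  have nilpotent := hn.dirac_iterate_eq_zero (EuclideanSpace.basisFun _ ℝ) (sliceSymbol p ω)
  rw [CK_comp_slice p f hω, funext (ckSeries_eq_diracExp hω hn.1 nilpotent)]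
  exact ⟨(contDiff_diracExp hn.1 nilpotent).of_le (by simp),
    solvesEvolution_diracExp hn.1 nilpotent⟩

theorem slice_zero (ω : Octonion) (x : Base p) : slice p ω (x, 0) = emb p x := by simp [slice]

theorem ckSeries_zero (p : Fin 7) (f : Base p → Octonion) (x : Base p) (ω : Octonion) :
    ckSeries p f x 0 ω = f x := by
  rw [ckSeries, tsum_eq_single 0 fun k hk => by simp [hk]]
  simp [negLaplacianPow]

theorem CK_emb (p : Fin 7) (f : Base p → Octonion) (x : Base p) : CK p f (emb p x) = f x := by
  obtain ⟨ω, hω, -⟩ := exists_slice_eq p 0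
  rw [← slice_zero ω, CK_slice p f hω x le_rfl, ckSeries_zero]

theorem eq_of_isGSM {g g' : Octonion → Octonion} (hg : IsGSM p Set.univ g)
    (hg' : IsGSM p Set.univ g') (h : ∀ x, g (emb p x) = g' (emb p x)) : g = g' := by
  ext1 z
  obtain ⟨ω, hω, y, rfl⟩ := exists_slice_eq p z
  obtain ⟨smooth, solves⟩ := isGSM_univ_iff.1 hg ω hω
  obtain ⟨smooth', solves'⟩ := isGSM_univ_iff.1 hg' ω hω
  have difference : g ∘ slice p ω - g' ∘ slice p ω = 0 :=
    (solves.sub solves' (smooth.differentiable one_ne_zero)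
      (smooth'.differentiable one_ne_zero)).eq_zero_of_initial (isCliffordAction_sliceSymbol hω)
        (smooth.sub smooth') fun x => by simp [slice_zero, h]
  exact congrFun (sub_eq_zero.1 difference) y

end Extension

end

end OctonionCK

theorem mainTheorem9 (p : Fin 7) (f₀ : OctonionCK.Base p → OctonionCK.Octonion)
    (hf₀ : OctonionCK.IsPolynomialMap p f₀) :
    OctonionCK.IsGSM p Set.univ (OctonionCK.CK p f₀) ∧
    (∀ x : OctonionCK.Base p, OctonionCK.CK p f₀ (OctonionCK.emb p x) = f₀ x) ∧
    (∀ g : OctonionCK.Octonion → OctonionCK.Octonion,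
      OctonionCK.IsGSM p Set.univ g →
      (∀ x : OctonionCK.Base p, g (OctonionCK.emb p x) = f₀ x) →
      g = OctonionCK.CK p f₀) :=
  ⟨OctonionCK.isGSM_CK hf₀, OctonionCK.CK_emb p f₀, fun _ hg h =>
    OctonionCK.eq_of_isGSM hg (OctonionCK.isGSM_CK hf₀) fun x =>
      (h x).trans (OctonionCK.CK_emb p f₀ x).symm⟩
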